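/- All spaces are metrizable. An \emph{ANR} is a metrizable space $M$ such that, whenever $M$ is embedded as a closed subset of a metrizable space $Z$, it is a retract of some neighborhood of itself in $Z$. A closed subset $X$ of an ANR $M$ is a \emph{Z-set} in $M$ if there is a homotopy $h_t\colon M\to M$, $t\in[0,1]$, such that $h_0=\mathrm{id}_M$ and $h_t(M)\subset M\setminus X$ for all $t>0$. Let $X$ be a closed Z-set in an ANR $M$ and let $K\subset M$ be compact. Then there exist a compact ANR $N$, an embedding $i\colon K\to N$ and a continuous map $f\colon N\to M$ such that 1. $f\circ i$ is the inclusion $K\hookrightarrow M$; 2. $i(K\cap X)$ is a Z-set in $N$; 3. $f^{-1}(X)=i(K\cap X)$; 4. every neighborhood of $i(K)$ in $N$ contains a compact ANR $N'$ such that $i(K)\subset N'$ and $i(K\cap X)$ is a Z-set in $N'$. -/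

import Mathlib

universe u

/-- An absolute neighborhood retract for the class of metrizable spaces: a metrizable space `M`
which, whenever it is embedded as a closed subset in a metrizable space `Z`, is a retract of
some open neighborhood `U` of its image. The retraction is written as a map `r : U → M`
that is a left inverse of the closed embedding `e`. The empty space is allowed. -/
def IsANR (M : Type u) [TopologicalSpace M] : Prop :=
  TopologicalSpace.MetrizableSpace M ∧
    ∀ (Z : Type u) [TopologicalSpace Z] [TopologicalSpace.MetrizableSpace Z] (e : M → Z),
      Topology.IsClosedEmbedding e →
        ∃ U : Set Z, IsOpen U ∧ ∃ hU : ∀ x, e x ∈ U,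
          ∃ r : C(U, M), ∀ x, r ⟨e x, hU x⟩ = x

/-- A closed subset `X` of `M` is a Z-set if its complement is homotopy dense: there is a homotopy
`h_t : M → M` with `h_0 = id` and `h_t(M) ⊆ M \ X` for every `t > 0`.
(Used only for ambient spaces `M` that are ANRs.) -/
def IsZSet {M : Type u} [TopologicalSpace M] (X : Set M) : Prop :=
  IsClosed X ∧
    ∃ h : C(M × unitInterval, M), (∀ x, h (x, 0) = x) ∧ ∀ x, ∀ t > 0, h (x, t) ∉ X

section

open Set Filter Topology Metric

/-! Embed `M` in a Banach space `E` by `φ`; the closed convex hull `D` of `φ(K)` is compact. Take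
for `N` a finite union of prisms in `D × [0, ε]` covering `φ(K) × 0`. Finite unions of closed convex
sets are neighborhood extensors (`isANESet_biUnion_of_convex`), so `N` is an ANR. Raising the height
makes closed subsets of height zero Z-sets (`isZSet_of_isEmbedding_of_snd_eq_zero`). Thinner prisms
give `N'`.

As `φ(M)` need not be closed in `E`, delete from `E × [0, ∞)` the other points of height zero: there
`M × 0` is closed, hence a neighborhood retract (`IsANR.exists_retraction`). Move `(v, t)` into this
space by changing its height to `τ = dist(v, φ(K)) + t`, retract to `M`, and apply the homotopy `h`
at time `τ`. Since `τ` vanishes only on `φ(K) × 0`, all other points of `N` are pushed off `X`. -/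

/-- A subset `A` of a space `E` is an absolute neighborhood extensor for metrizable spaces: every
continuous map into `A` from a closed subset of a metrizable space extends to a neighborhood. -/
def IsANESet {E : Type*} [TopologicalSpace E] (A : Set E) : Prop :=
  ∀ (Y : Type u) [TopologicalSpace Y] [TopologicalSpace.MetrizableSpace Y] (F : Set Y) (f : Y → E),
    IsClosed F → ContinuousOn f F → MapsTo f F A →
      ∃ (g : Y → E) (V : Set Y), IsOpen V ∧ F ⊆ V ∧ ContinuousOn g V ∧ MapsTo g V A ∧ EqOn g f F

/-! ### Neighborhood extensors: convex sets and their finite unions -/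

/-- Dugundji's extension theorem, for convex subsets of a normed space. -/
theorem Convex.exists_continuous_extension {Y E : Type*} [MetricSpace Y]
    [NormedAddCommGroup E] [NormedSpace ℝ E] {C : Set E} (hC : Convex ℝ C) {F : Set Y} {f : Y → E}
    (hF : IsClosed F) (hne : F.Nonempty) (hf : ContinuousOn f F) (hfC : MapsTo f F C) :
    ∃ g : Y → E, Continuous g ∧ (∀ y, g y ∈ C) ∧ EqOn g f F := by
  classical
  obtain ⟨g₀, hg₀⟩ := exists_continuous_forall_mem_convex_of_local_const
    (X := ↥Fᶜ) (t := fun y => convexHull ℝ (f '' (F ∩ ball (y : Y) (2 * infDist (y : Y) F))))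
    (fun y => convex_convexHull ℝ _) (by
      intro y
      have hpos : 0 < infDist (y : Y) F := (hF.notMem_iff_infDist_pos hne).1 y.2
      obtain ⟨a, haF, ha⟩ := (infDist_lt_iff hne).1
        (show infDist (y : Y) F < 2 * infDist (y : Y) F by linarith)
      refine ⟨f a, ?_⟩
      have hc : Continuous fun z : ↥Fᶜ => dist (z : Y) a :=
        continuous_subtype_val.dist continuous_const
      have hd : Continuous fun z : ↥Fᶜ => 2 * infDist (z : Y) F :=
        continuous_const.mul ((continuous_infDist_pt F).comp continuous_subtype_val)
      filter_upwards [hc.continuousAt.eventually_lt hd.continuousAt ha] with z hz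
      exact subset_convexHull ℝ _ ⟨a, ⟨haF, by rwa [mem_ball, dist_comm]⟩, rfl⟩)
  refine ⟨fun y => if h : y ∈ F then f y else g₀ ⟨y, h⟩, ?_, ?_, fun y hy => dif_pos hy⟩
  · rw [continuous_iff_continuousAt]
    intro x
    by_cases hx : x ∈ F
    · rw [Metric.continuousAt_iff]
      intro ε hε
      obtain ⟨δ, hδ, hfδ⟩ := Metric.continuousWithinAt_iff.1 (hf x hx) ε hε
      -- The points `a` used at `y` satisfy `dist a y < 2 * infDist y F ≤ 2 * dist y x`, so `dist a
      -- x < 3 * dist y x < δ`.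
      refine ⟨δ / 3, by positivity, fun {y} hy => ?_⟩
      by_cases hyF : y ∈ F
      · simpa [hx, hyF] using hfδ hyF (by linarith)
      · simp only [hx, hyF, dif_pos, dif_neg, not_false_eq_true]
        refine convexHull_min ?_ (convex_ball (f x) ε) (hg₀ ⟨y, hyF⟩)
        rintro _ ⟨a, ⟨haF, ha⟩, rfl⟩
        refine hfδ haF ?_
        have h1 : infDist y F ≤ dist y x := infDist_le_dist_of_mem hx
        have h2 := mem_ball.1 ha
        have h3 := dist_triangle a y x
        dsimp only at h2
        linarith
    · have hcont : ContinuousOn (fun y => if h : y ∈ F then f y else g₀ ⟨y, h⟩) Fᶜ := by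
        rw [continuousOn_iff_continuous_domRestrict]
        convert g₀.continuous using 1
        ext y
        exact dif_neg y.2
      exact hcont.continuousAt (hF.isOpen_compl.mem_nhds hx)
  · intro y
    by_cases hy : y ∈ F
    · simpa [hy] using hfC hy
    · simp only [hy, dif_neg, not_false_eq_true]
      refine convexHull_min ?_ hC (hg₀ ⟨y, hy⟩)
      rintro _ ⟨a, ⟨haF, -⟩, rfl⟩
      exact hfC haF

theorem Convex.isANESet {E : Type*} [NormedAddCommGroup E] [NormedSpace ℝ E] {C : Set E}
    (hC : Convex ℝ C) : IsANESet.{u} C := by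
  intro Y _ _ F f hF hf hfC
  let _ := TopologicalSpace.metrizableSpaceMetric Y
  rcases F.eq_empty_or_nonempty with rfl | hne
  · exact ⟨f, ∅, isOpen_empty, Subset.rfl, continuousOn_empty f, fun _ h => h.elim,
      fun _ h => h.elim⟩
  · obtain ⟨g, hg, hgC, hgf⟩ := hC.exists_continuous_extension hF hne hf hfC
    exact ⟨g, univ, isOpen_univ, subset_univ F, hg.continuousOn, fun y _ => hgC y, hgf⟩

/-- Closed subsets `A`, `B` of a metrizable space are the traces on `A ∪ B` of two closed sets
covering the space. -/
theorem exists_isClosed_cover_inter_union {Y : Type*} [TopologicalSpace Y]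
    [TopologicalSpace.MetrizableSpace Y] {A B : Set Y} (hA : IsClosed A) (hB : IsClosed B) :
    ∃ P Q : Set Y, IsClosed P ∧ IsClosed Q ∧ P ∪ Q = univ ∧ A ⊆ P ∧ B ⊆ Q ∧
      B ∩ P ⊆ A ∧ A ∩ Q ⊆ B := by
  let _ := TopologicalSpace.metrizableSpaceMetric Y
  have h0 : ∀ {S : Set Y} {y : Y}, y ∈ S → infEDist y S = 0 := fun h => infEDist_zero_of_mem h
  refine ⟨{y | infEDist y A ≤ infEDist y B}, {y | infEDist y B ≤ infEDist y A},
    isClosed_le continuous_infEDist continuous_infEDist,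
    isClosed_le continuous_infEDist continuous_infEDist,
    eq_univ_of_forall fun y => le_total (infEDist y A) (infEDist y B), fun y hy => ?_, fun y hy => ?_, ?_, ?_⟩
  · simp [h0 hy]
  · simp [h0 hy]
  · rintro y ⟨hy, hle⟩
    rw [mem_ofPred_eq, h0 hy, nonpos_iff_eq_zero] at hle
    exact (mem_iff_infEDist_zero_of_closed hA).2 hle
  · rintro y ⟨hy, hle⟩
    rw [mem_ofPred_eq, h0 hy, nonpos_iff_eq_zero] at hle
    exact (mem_iff_infEDist_zero_of_closed hB).2 hle

/-- Extend first into `A ∩ B`, obtaining `g₀`. The extensions into `A` over `P` and into `B` over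
`Q` are both made to equal `g₀` on `P ∩ Q` near the overlap, so they glue. -/
theorem IsANESet.union {E : Type*} [TopologicalSpace E] {A B : Set E} (hAc : IsClosed A)
    (hBc : IsClosed B) (hA : IsANESet.{u} A) (hB : IsANESet.{u} B) (hAB : IsANESet.{u} (A ∩ B)) :
    IsANESet.{u} (A ∪ B) := by
  classical
  intro Y _ _ F f hF hf hfAB
  let _ := TopologicalSpace.metrizableSpaceMetric Y
  have hFA : IsClosed (F ∩ f ⁻¹' A) := hf.preimage_isClosed_of_isClosed hF hAc
  have hFB : IsClosed (F ∩ f ⁻¹' B) := hf.preimage_isClosed_of_isClosed hF hBc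
  obtain ⟨P, Q, hP, hQ, hPQ, hAP, hBQ, hBP, hAQ⟩ := exists_isClosed_cover_inter_union hFA hFB
  obtain ⟨g₀, V₀, hV₀, hFV₀, hg₀, hg₀AB, hg₀f⟩ := hAB Y ((F ∩ f ⁻¹' A) ∩ (F ∩ f ⁻¹' B)) f
    (hFA.inter hFB) (hf.mono fun y hy => hy.1.1) fun y hy => ⟨hy.1.2, hy.2.2⟩
  obtain ⟨W, hW, hFW, hWV₀⟩ := normal_exists_closure_subset (hFA.inter hFB) hV₀ hFV₀
  have key : ∀ {S : Set E}, IsANESet.{u} S → A ∩ B ⊆ S →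
      IsClosed (F ∩ f ⁻¹' S) →
      (F ∩ f ⁻¹' S) ∩ (P ∩ Q) ⊆ (F ∩ f ⁻¹' A) ∩ (F ∩ f ⁻¹' B) →
      ∃ (g : Y → E) (V : Set Y), IsOpen V ∧ F ∩ f ⁻¹' S ⊆ V ∧ closure W ∩ (P ∩ Q) ⊆ V ∧
        ContinuousOn g V ∧ MapsTo g V S ∧ EqOn g f (F ∩ f ⁻¹' S) ∧
        EqOn g g₀ (closure W ∩ (P ∩ Q)) := by
    intro S hS hABS hFS hsub
    set g₁ : Y → E := fun y => if y ∈ F then f y else g₀ y with hg₁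
    have h1 : EqOn g₁ f (F ∩ f ⁻¹' S) := fun y hy => if_pos hy.1
    have h2 : EqOn g₁ g₀ (closure W ∩ (P ∩ Q)) := by
      intro y hy
      by_cases hyF : y ∈ F
      · rw [hg₁]
        simp only [hyF, if_true]
        refine (hg₀f ?_).symm
        rcases hfAB hyF with h | h
        · exact ⟨⟨hyF, h⟩, hAQ ⟨⟨hyF, h⟩, hy.2.2⟩⟩
        · exact ⟨hBP ⟨⟨hyF, h⟩, hy.2.1⟩, ⟨hyF, h⟩⟩
      · exact if_neg hyF
    have hWc : IsClosed (closure W ∩ (P ∩ Q)) := isClosed_closure.inter (hP.inter hQ)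
    obtain ⟨g, V, hV, hsV, hg, hgS, hgg⟩ := hS Y ((F ∩ f ⁻¹' S) ∪ (closure W ∩ (P ∩ Q))) g₁
      (hFS.union hWc)
      (((hf.mono inter_subset_left).congr h1).union_of_isClosed
        ((hg₀.mono (inter_subset_left.trans hWV₀)).congr h2) hFS hWc)
      (by
        rintro y (hy | hy)
        · rw [h1 hy]; exact hy.2
        · rw [h2 hy]; exact hABS (hg₀AB (hWV₀ hy.1)))
    exact ⟨g, V, hV, subset_union_left.trans hsV, subset_union_right.trans hsV, hg, hgS,
      (hgg.mono subset_union_left).trans h1, (hgg.mono subset_union_right).trans h2⟩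
  obtain ⟨gA, VA, hVA, hFVA, hWVA, hgA, hgAA, hgAf, hgA0⟩ := key hA inter_subset_left hFA
    fun y hy => ⟨hy.1, hAQ ⟨hy.1, hy.2.2⟩⟩
  obtain ⟨gB, VB, hVB, hFVB, hWVB, hgB, hgBB, hgBf, hgB0⟩ := key hB inter_subset_right hFB
    fun y hy => ⟨hBP ⟨hy.1, hy.2.1⟩, hy.1⟩
  -- On `O`, `gA` is controlled over `P`, `gB` over `Q`, and `P ∩ Q` lies in `W`, where both equal
  -- `g₀`.
  set O : Set Y := (VA ∪ Pᶜ) ∩ (VB ∪ Qᶜ) ∩ ((P ∩ Q)ᶜ ∪ W)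
  have hOopen : IsOpen O := ((hVA.union hP.isOpen_compl).inter (hVB.union hQ.isOpen_compl)).inter
    ((hP.inter hQ).isOpen_compl.union hW)
  have hFO : F ⊆ O := by
    intro y hy
    refine ⟨⟨?_, ?_⟩, ?_⟩
    · by_cases hyP : y ∈ P
      · left
        rcases hfAB hy with h | h
        · exact hFVA ⟨hy, h⟩
        · exact hFVA (hBP ⟨⟨hy, h⟩, hyP⟩)
      · exact Or.inr hyP
    · by_cases hyQ : y ∈ Q
      · left
        rcases hfAB hy with h | h
        · exact hFVB (hAQ ⟨⟨hy, h⟩, hyQ⟩)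
        · exact hFVB ⟨hy, h⟩
      · exact Or.inr hyQ
    · by_cases hyPQ : y ∈ P ∩ Q
      · right
        apply hFW
        rcases hfAB hy with h | h
        · exact ⟨⟨hy, h⟩, hAQ ⟨⟨hy, h⟩, hyPQ.2⟩⟩
        · exact ⟨hBP ⟨⟨hy, h⟩, hyPQ.1⟩, ⟨hy, h⟩⟩
      · exact Or.inl hyPQ
  have hOP : O ∩ P ⊆ VA := fun y hy => hy.1.1.1.resolve_right (not_not.2 hy.2)
  have hOQ : O ∩ Q ⊆ VB := fun y hy => hy.1.1.2.resolve_right (not_not.2 hy.2)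
  have hOPQ : ∀ y ∈ O, y ∈ P → y ∈ Q → gA y = gB y := by
    intro y hy hyP hyQ
    have hyW : y ∈ closure W := subset_closure (hy.2.resolve_left (not_not.2 ⟨hyP, hyQ⟩))
    rw [hgA0 ⟨hyW, hyP, hyQ⟩, hgB0 ⟨hyW, hyP, hyQ⟩]
  set g : Y → E := fun y => if y ∈ P then gA y else gB y
  have hgP : ∀ y ∈ P, g y = gA y := fun y hy => if_pos hy
  have hgQ : ∀ y ∈ O ∩ Q, g y = gB y := by
    rintro y ⟨hy, hyQ⟩
    by_cases hyP : y ∈ P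
    · rw [hgP y hyP, hOPQ y hy hyP hyQ]
    · exact if_neg hyP
  have hQ' : ∀ y, y ∉ P → y ∈ Q := fun y hy => (hPQ.ge (mem_univ y)).resolve_left hy
  refine ⟨g, O, hOopen, hFO, ?_, ?_, ?_⟩
  · have hcP : ContinuousOn g (O ∩ P) := (hgA.mono hOP).congr fun y hy => hgP y hy.2
    have hcQ : ContinuousOn g (O ∩ Q) := (hgB.mono hOQ).congr hgQ
    rw [continuousOn_iff_continuous_domRestrict]
    have hc := ContinuousOn.union_of_isClosed (f := O.domRestrict g)
      (s := Subtype.val ⁻¹' P) (t := Subtype.val ⁻¹' Q)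
      (hcP.comp continuous_subtype_val.continuousOn fun y hy => ⟨y.2, hy⟩)
      (hcQ.comp continuous_subtype_val.continuousOn fun y hy => ⟨y.2, hy⟩)
      (hP.preimage continuous_subtype_val) (hQ.preimage continuous_subtype_val)
    rwa [← preimage_union, hPQ, preimage_univ, continuousOn_univ] at hc
  · intro y hy
    by_cases hyP : y ∈ P
    · rw [hgP y hyP]
      exact Or.inl (hgAA (hOP ⟨hy, hyP⟩))
    · rw [hgQ y ⟨hy, hQ' y hyP⟩]
      exact Or.inr (hgBB (hOQ ⟨hy, hQ' y hyP⟩))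
  · intro y hy
    by_cases hyP : y ∈ P
    · rw [hgP y hyP]
      rcases hfAB hy with h | h
      · exact hgAf ⟨hy, h⟩
      · exact hgAf (hBP ⟨⟨hy, h⟩, hyP⟩)
    · rw [hgQ y ⟨hFO hy, hQ' y hyP⟩]
      rcases hfAB hy with h | h
      · exact absurd (hAP ⟨hy, h⟩) hyP
      · exact hgBf ⟨hy, h⟩

/-- Induction over all families at once: the intersection required by `IsANESet.union` is again a
union of fewer closed convex sets. -/
theorem isANESet_biUnion_of_convex {ι E : Type*} [NormedAddCommGroup E] [NormedSpace ℝ E]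
    (s : Finset ι) (c : ι → Set E) (hconv : ∀ i, Convex ℝ (c i)) (hcl : ∀ i, IsClosed (c i)) :
    IsANESet.{u} (⋃ i ∈ s, c i) := by
  classical
  induction s using Finset.induction_on generalizing c with
  | empty => simpa using (convex_empty (𝕜 := ℝ) (E := E)).isANESet
  | insert a s _ ih =>
    rw [Finset.set_biUnion_insert]
    refine IsANESet.union (hcl a) (isClosed_biUnion_finset fun i _ => hcl i) (hconv a).isANESet
      (ih c hconv hcl) ?_
    rw [inter_iUnion₂]
    exact ih (fun i => c a ∩ c i) (fun i => (hconv a).inter (hconv i))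
      fun i => (hcl a).inter (hcl i)

/-! ### From extensors to ANRs, and the embedding into a Banach space -/

theorem IsANESet.isANR {T : Type u} {E : Type*} [TopologicalSpace T] [TopologicalSpace E]
    [TopologicalSpace.MetrizableSpace E] [Nonempty E] {j : T → E} (hj : IsEmbedding j)
    (h : IsANESet.{u} (range j)) : IsANR T := by
  refine ⟨hj.metrizableSpace, fun Z _ _ e he => ?_⟩
  obtain ⟨z⟩ := ‹Nonempty E›
  have hext : ∀ x, Function.extend e j (fun _ => z) (e x) = j x := fun x =>
    he.injective.extend_apply j _ x
  obtain ⟨g, V, hV, hFV, hg, hgr, hgj⟩ := h Z (range e) (Function.extend e j fun _ => z)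
    he.isClosed_range (by
      rw [continuousOn_iff_continuous_domRestrict,
        ← he.isEmbedding.toHomeomorph.comp_continuous_iff']
      exact hj.continuous.congr fun x => (hext x).symm)
    (by rintro _ ⟨x, rfl⟩; rw [hext]; exact mem_range_self x)
  refine ⟨V, hV, fun x => hFV (mem_range_self x),
    ⟨fun v => hj.toHomeomorph.symm ⟨g v, hgr v.2⟩, hj.toHomeomorph.symm.continuous.comp
      ((continuousOn_iff_continuous_domRestrict.1 hg).subtype_mk _)⟩, fun x => ?_⟩
  refine (Homeomorph.symm_apply_eq _).2 (Subtype.ext ?_)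
  change g (e x) = j x
  rw [hgj (mem_range_self x), hext]

theorem exists_isEmbedding_boundedContinuousFunction (M : Type*) [TopologicalSpace M]
    [TopologicalSpace.MetrizableSpace M] :
    ∃ φ : M → BoundedContinuousFunction M ℝ, IsEmbedding φ := by
  let _ := TopologicalSpace.metrizableSpaceMetric M
  rcases isEmpty_or_nonempty M with hM | ⟨⟨x₀⟩⟩
  · exact ⟨fun _ => 0, .of_subsingleton _⟩
  -- Kuratowski's embedding; subtracting `dist x₀ y` makes the functions bounded.
  refine ⟨fun x => BoundedContinuousFunction.ofNormedAddCommGroup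
    (fun y => dist x y - dist x₀ y) (by fun_prop) (dist x x₀)
    (fun y => abs_dist_sub_le x x₀ y), Isometry.isEmbedding ?_⟩
  refine Isometry.of_dist_eq fun x x' => le_antisymm ?_ ?_
  · refine (BoundedContinuousFunction.dist_le dist_nonneg).2 fun y => ?_
    simpa [Real.dist_eq] using abs_dist_sub_le x x' y
  · refine le_trans ?_ (BoundedContinuousFunction.dist_coe_le_dist x')
    simp

/-! ### Prisms and Z-sets at height zero -/

/-- The union of the products with `[0, ε]` of the traces on `D` of the closed `ε`-balls around
finitely many points. -/
def ballPrisms {E : Type*} [PseudoMetricSpace E] (D : Set E) (s : Finset E) (ε : ℝ) :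
    Set (E × ℝ) :=
  ⋃ x ∈ s, (closedBall x ε ∩ D) ×ˢ Icc 0 ε

theorem mem_ballPrisms {E : Type*} [PseudoMetricSpace E] {D : Set E} {s : Finset E} {ε : ℝ}
    {p : E × ℝ} :
    p ∈ ballPrisms D s ε ↔ ∃ x ∈ s, (dist p.1 x ≤ ε ∧ p.1 ∈ D) ∧ 0 ≤ p.2 ∧ p.2 ≤ ε := by
  simp only [ballPrisms, mem_iUnion, mem_prod, mem_inter_iff, mem_closedBall, mem_Icc,
    exists_prop]

theorem ballPrisms_subset {E : Type*} [PseudoMetricSpace E] {D : Set E} {s : Finset E} {ε : ℝ} :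
    ballPrisms D s ε ⊆ D ×ˢ Ici 0 := by
  intro p hp
  obtain ⟨x, -, ⟨-, hD⟩, h0, -⟩ := mem_ballPrisms.1 hp
  exact ⟨hD, h0⟩

theorem mk_max_mem_ballPrisms {E : Type*} [PseudoMetricSpace E] {D : Set E} {s : Finset E} {ε : ℝ}
    (hε : 0 ≤ ε) {p : E × ℝ} (hp : p ∈ ballPrisms D s ε) (t : unitInterval) :
    (p.1, max p.2 (ε * t)) ∈ ballPrisms D s ε := by
  obtain ⟨x, hx, h, h0, h1⟩ := mem_ballPrisms.1 hp
  exact mem_ballPrisms.2 ⟨x, hx, h, le_max_of_le_left h0,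
    max_le h1 (mul_le_of_le_one_right hε t.2.2)⟩

theorem isCompact_ballPrisms {E : Type*} [PseudoMetricSpace E] {D : Set E} (hD : IsCompact D)
    (s : Finset E) (ε : ℝ) : IsCompact (ballPrisms D s ε) :=
  s.isCompact_biUnion fun _ _ => (hD.inter_left isClosed_closedBall).prod isCompact_Icc

theorem isANESet_ballPrisms {E : Type*} [NormedAddCommGroup E] [NormedSpace ℝ E] {D : Set E}
    (hD : IsCompact D) (hDc : Convex ℝ D) (s : Finset E) (ε : ℝ) :
    IsANESet.{u} (ballPrisms D s ε) :=
  isANESet_biUnion_of_convex s _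
    (fun x => ((convex_closedBall x ε).inter hDc).prod (convex_Icc 0 ε))
    fun _ => (isClosed_closedBall.inter hD.isClosed).prod isClosed_Icc

theorem exists_ballPrisms_subset {E : Type*} [PseudoMetricSpace E] {D K : Set E}
    (hKD : K ⊆ D) (hK : IsCompact K) {V : Set (E × ℝ)} (hV : IsOpen V) (hKV : K ×ˢ {0} ⊆ V) :
    ∃ (s : Finset E) (ε : ℝ), 0 < ε ∧ K ×ˢ {0} ⊆ ballPrisms D s ε ∧ ballPrisms D s ε ⊆ V ∧
      ∃ O : Set (E × ℝ), IsOpen O ∧ K ×ˢ {0} ⊆ O ∧ O ∩ D ×ˢ Ici 0 ⊆ ballPrisms D s ε := by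
  obtain ⟨ε, hε, hεV⟩ :=
    (hK.prod (isCompact_singleton (x := (0 : ℝ)))).exists_cthickening_subset_open hV hKV
  obtain ⟨t, htK, htf, hKt⟩ := hK.finite_cover_balls hε
  have hO : (⋃ x ∈ t, ball x ε) ×ˢ Iio ε ∩ D ×ˢ Ici 0 ⊆ ballPrisms D htf.toFinset ε := by
    rintro p ⟨⟨hp, hpε⟩, hpD, hp0⟩
    obtain ⟨x, hx, hpx⟩ := mem_iUnion₂.1 hp
    exact mem_ballPrisms.2 ⟨x, by simpa using hx, ⟨(mem_ball.1 hpx).le, hpD⟩, hp0, le_of_lt hpε⟩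
  have hKO : K ×ˢ {0} ⊆ (⋃ x ∈ t, ball x ε) ×ˢ Iio ε := by
    rintro p ⟨hp, hp0⟩
    exact ⟨hKt hp, by rw [mem_singleton_iff.1 hp0]; exact hε⟩
  refine ⟨htf.toFinset, ε, hε, fun p hp => hO ⟨hKO hp, hKD hp.1, ?_⟩, fun p hp => ?_, _,
    (isOpen_biUnion fun _ _ => isOpen_ball).prod isOpen_Iio, hKO, hO⟩
  · exact (mem_singleton_iff.1 hp.2).ge
  · obtain ⟨x, hx, ⟨hpx, -⟩, h0, h1⟩ := mem_ballPrisms.1 hp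
    refine hεV (mem_cthickening_of_dist_le p (x, 0) ε _ ⟨htK (by simpa using hx), rfl⟩ ?_)
    rw [Prod.dist_eq]
    exact max_le hpx (by rwa [Real.dist_eq, sub_zero, abs_of_nonneg h0])

theorem isZSet_of_isEmbedding_of_snd_eq_zero {T : Type u} {E : Type*} [TopologicalSpace T]
    [TopologicalSpace E] {j : T → E × ℝ} (hj : IsEmbedding j) {ε : ℝ} (hε : 0 < ε)
    (hmax : ∀ p ∈ range j, ∀ t : unitInterval, (p.1, max p.2 (ε * t)) ∈ range j)
    (h0 : ∀ x, 0 ≤ (j x).2) {X : Set T} (hX : IsClosed X) (hX0 : ∀ x ∈ X, (j x).2 = 0) :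
    IsZSet X := by
  have hc : Continuous fun q : T × unitInterval => ((j q.1).1, max (j q.1).2 (ε * (q.2 : ℝ))) := by
    have := hj.continuous
    fun_prop
  have hjs : ∀ p, j (hj.toHomeomorph.symm p) = p := fun p =>
    congrArg Subtype.val (hj.toHomeomorph.apply_symm_apply p)
  -- The homotopy raises the height to at least `ε * t`; a maximum, unlike a sum, does not leave
  -- prisms of height `ε`.
  refine ⟨hX, ⟨fun q => hj.toHomeomorph.symm ⟨_, hmax (j q.1) (mem_range_self _) q.2⟩,
    hj.toHomeomorph.symm.continuous.comp (hc.subtype_mk _)⟩, fun x => ?_, fun x t ht hmem => ?_⟩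
  · apply hj.injective
    refine (hjs _).trans (Prod.ext rfl ?_)
    simpa using h0 x
  · have h := hX0 _ hmem
    erw [hjs] at h
    have hpos : 0 < ε * (t : ℝ) := mul_pos hε ht
    exact absurd h (hpos.trans_le (le_max_right _ _)).ne'

/-- An ANR embedded at height zero in `E × [0, ∞)` is a neighborhood retract of the subspace obtained
by deleting the other points of height zero. -/
theorem IsANR.exists_retraction {M E : Type u} [TopologicalSpace M] [TopologicalSpace E]
    [TopologicalSpace.MetrizableSpace E] (hM : IsANR M) {φ : M → E} (hφ : IsEmbedding φ) :
    ∃ U : Set {p : E × ℝ // 0 ≤ p.2 ∧ (p.2 = 0 → p.1 ∈ range φ)}, IsOpen U ∧ ∃ r : C(U, M),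
      ∀ x, ∃ hx : (⟨(φ x, 0), le_rfl, fun _ => mem_range_self x⟩ :
        {p : E × ℝ // 0 ≤ p.2 ∧ (p.2 = 0 → p.1 ∈ range φ)}) ∈ U, r ⟨_, hx⟩ = x := by
  let e : M → {p : E × ℝ // 0 ≤ p.2 ∧ (p.2 = 0 → p.1 ∈ range φ)} :=
    fun x => ⟨(φ x, 0), le_rfl, fun _ => mem_range_self x⟩
  have he : IsClosedEmbedding e := by
    refine ⟨IsEmbedding.of_comp ((hφ.continuous.prodMk continuous_const).subtype_mk _)
      (continuous_fst.comp continuous_subtype_val) hφ, ?_⟩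
    convert isClosed_singleton (x := (0 : ℝ)).preimage (continuous_snd.comp continuous_subtype_val)
    ext p
    constructor
    · rintro ⟨x, rfl⟩
      rfl
    · intro hp
      obtain ⟨x, hx⟩ := p.2.2 hp
      exact ⟨x, Subtype.ext (Prod.ext hx (Eq.symm hp))⟩
  have := IsEmbedding.metrizableSpace (IsEmbedding.subtypeVal
    (p := fun p : E × ℝ => 0 ≤ p.2 ∧ (p.2 = 0 → p.1 ∈ range φ)))
  obtain ⟨U, hU, heU, r, hr⟩ := hM.2 _ e he
  exact ⟨U, hU, r, fun x => ⟨heU x, hr x⟩⟩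

theorem IsCompact.isCompact_closure_convexHull {E : Type*} [NormedAddCommGroup E]
    [NormedSpace ℝ E] [CompleteSpace E] {K : Set E} (hK : IsCompact K) :
    IsCompact (closure (convexHull ℝ K)) :=
  isCompact_iff_totallyBounded_isComplete.2
    ⟨hK.totallyBounded.convexHull.closure, isClosed_closure.isComplete⟩

end

/-! ### Construction of `N`, `f` and `N'` -/

open Set Filter Topology Metric in
theorem mainTheorem10 {M : Type u} [TopologicalSpace M] (hM : IsANR M)
    (X : Set M) (hX : IsZSet X) (K : Set M) (hK : IsCompact K) :
    ∃ (N : Type u) (_ : TopologicalSpace N), CompactSpace N ∧ IsANR N ∧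
      ∃ (i : K → N) (f : C(N, M)),
        Topology.IsEmbedding i ∧
        (∀ x : K, f (i x) = x) ∧
        IsZSet (i '' {x : K | (x : M) ∈ X}) ∧
        f ⁻¹' X = i '' {x : K | (x : M) ∈ X} ∧
        ∀ U ∈ nhdsSet (Set.range i), ∃ N' : Set N,
          Set.range i ⊆ N' ∧ N' ⊆ U ∧ IsCompact N' ∧ IsANR N' ∧
          IsZSet {y : N' | (y : N) ∈ i '' {x : K | (x : M) ∈ X}} := by
  have := hM.1
  obtain ⟨hXc, h, hh0, hhX⟩ := hX
  obtain ⟨φ, hφ⟩ := exists_isEmbedding_boundedContinuousFunction M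
  obtain ⟨U, hU, r, hr⟩ := hM.exists_retraction hφ
  have hK' : IsCompact (φ '' K) := hK.image hφ.continuous
  set D := closure (convexHull ℝ (φ '' K))
  have hD : IsCompact D := hK'.isCompact_closure_convexHull
  have hDc : Convex ℝ D := (convex_convexHull ℝ _).closure
  have hKD : φ '' K ⊆ D := (subset_convexHull ℝ _).trans subset_closure
  have hne : D.Nonempty → (φ '' K).Nonempty := fun hn =>
    convexHull_nonempty_iff.1 (closure_nonempty_iff.1 hn)
  have hd : ∀ v ∈ D, infDist v (φ '' K) = 0 → v ∈ φ '' K := fun v hv h0 =>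
    (hK'.isClosed.mem_iff_infDist_zero (hne ⟨v, hv⟩)).2 h0
  let τ : BoundedContinuousFunction M ℝ × ℝ → ℝ := fun p => infDist p.1 (φ '' K) + p.2
  have hτc : Continuous τ := ((continuous_infDist_pt _).comp continuous_fst).add continuous_snd
  have hτ0 : ∀ p ∈ D ×ˢ Ici 0, 0 ≤ τ p := fun p hp => add_nonneg infDist_nonneg hp.2
  have hτK : ∀ p ∈ D ×ˢ Ici 0, τ p = 0 → p.1 ∈ φ '' K ∧ p.2 = 0 := fun p hp h0 => by
    obtain ⟨h1, h2⟩ := (add_eq_zero_iff_of_nonneg infDist_nonneg hp.2).1 h0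
    exact ⟨hd _ hp.1 h1, h2⟩
  have hτφ : ∀ x ∈ K, τ (φ x, 0) = 0 := fun x hx => by
    simp [τ, infDist_zero_of_mem (mem_image_of_mem φ hx)]
  let J : ↥(D ×ˢ Ici (0 : ℝ)) →
      {p : BoundedContinuousFunction M ℝ × ℝ // 0 ≤ p.2 ∧ (p.2 = 0 → p.1 ∈ range φ)} :=
    fun p => ⟨(p.1.1, τ p), hτ0 p p.2, fun h0 => image_subset_range φ K (hτK p p.2 h0).1⟩
  have hJ : Continuous J := by
    refine Continuous.subtype_mk ?_ _
    fun_prop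
  have hJφ : ∀ x (hx : x ∈ K), J ⟨(φ x, 0), hKD ⟨x, hx, rfl⟩, self_mem_Ici⟩ =
      ⟨(φ x, 0), le_rfl, fun _ => mem_range_self x⟩ := fun x hx =>
    Subtype.ext (Prod.ext rfl (hτφ x hx))
  -- Prisms inside `V` are carried by `J` into the domain of `r`.
  obtain ⟨V, hV, hVU⟩ := isOpen_induced_iff.1 (hU.preimage hJ)
  have hKV : (φ '' K) ×ˢ {0} ⊆ V := by
    rintro ⟨_, _⟩ ⟨⟨x, hx, rfl⟩, rfl⟩
    have hmem : (⟨(φ x, 0), hKD ⟨x, hx, rfl⟩, self_mem_Ici⟩ : ↥(D ×ˢ Ici (0 : ℝ))) ∈ J ⁻¹' U := by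
      rw [mem_preimage, hJφ x hx]
      exact (hr x).1
    rw [← hVU] at hmem
    exact hmem
  obtain ⟨s, ε, hε, hKN, hNV, O, hO, hKO, hON⟩ := exists_ballPrisms_subset hKD hK' hV hKV
  set N := ballPrisms D s ε
  have hNJ : ∀ p : N, J ⟨p, ballPrisms_subset p.2⟩ ∈ U := fun p => by
    have : (⟨p, ballPrisms_subset p.2⟩ : ↥(D ×ˢ Ici (0 : ℝ))) ∈ J ⁻¹' U := by
      rw [← hVU]
      exact hNV p.2
    exact this
  have hi : ∀ x : K, (φ x, (0 : ℝ)) ∈ N := fun x => hKN ⟨⟨x, x.2, rfl⟩, rfl⟩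
  let i : K → N := fun x => ⟨(φ x, 0), hi x⟩
  have hie : IsEmbedding i :=
    IsEmbedding.of_comp (((hφ.continuous.comp continuous_subtype_val).prodMk
      continuous_const).subtype_mk _) (continuous_fst.comp continuous_subtype_val)
      (hφ.comp .subtypeVal)
  let f : C(N, M) := ⟨fun p => h (r ⟨_, hNJ p⟩, projIcc 0 1 zero_le_one (τ p)), by
    have h1 : Continuous fun p : N => J ⟨p, ballPrisms_subset p.2⟩ :=
      hJ.comp (continuous_subtype_val.subtype_mk _)
    exact h.continuous.comp ((r.continuous.comp (h1.subtype_mk _)).prodMk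
      (continuous_projIcc.comp (hτc.comp continuous_subtype_val)))⟩
  have hfi : ∀ x : K, f (i x) = x := fun x => by
    change h (r ⟨_, hNJ (i x)⟩, projIcc 0 1 zero_le_one (τ (φ x, 0))) = x
    rw [hτφ x x.2, projIcc_left]
    refine (hh0 _).trans ?_
    obtain ⟨hx, hrx⟩ := hr (x : M)
    rw [← hrx]
    congr 1
    exact Subtype.ext (hJφ x x.2)
  have : CompactSpace K := isCompact_iff_compactSpace.1 hK
  have : CompactSpace N := isCompact_iff_compactSpace.1 (isCompact_ballPrisms hD s ε)
  have hiX : IsClosed (i '' {x : K | (x : M) ∈ X}) :=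
    ((hXc.preimage continuous_subtype_val).isCompact.image hie.continuous).isClosed
  have hiX0 : ∀ p ∈ i '' {x : K | (x : M) ∈ X}, p.1.2 = 0 := by
    rintro _ ⟨x, -, rfl⟩
    rfl
  refine ⟨N, inferInstance, inferInstance,
    IsANESet.isANR .subtypeVal
      (by rw [Subtype.range_val]; exact isANESet_ballPrisms hD hDc s ε), i, f, hie, hfi,
    isZSet_of_isEmbedding_of_snd_eq_zero .subtypeVal hε
      (by rw [Subtype.range_val]; exact fun p hp t => mk_max_mem_ballPrisms hε.le hp t)
      (fun p => (ballPrisms_subset p.2).2) hiX hiX0, ?_, fun W hW => ?_⟩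
  · ext p
    constructor
    · intro hp
      have hp0 : τ p = 0 := by
        by_contra hne0
        have hpos : 0 < τ p := (hτ0 p (ballPrisms_subset p.2)).lt_of_ne' hne0
        refine hhX _ (projIcc 0 1 zero_le_one (τ p)) ?_ hp
        change (0 : ℝ) < max 0 (min 1 (τ p))
        exact lt_max_of_lt_right (lt_min one_pos hpos)
      obtain ⟨⟨x, hx, hxp⟩, hp2⟩ := hτK p (ballPrisms_subset p.2) hp0
      have hip : i ⟨x, hx⟩ = p := Subtype.ext (Prod.ext hxp hp2.symm)
      refine ⟨⟨x, hx⟩, ?_, hip⟩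
      rw [← hip, mem_preimage, hfi] at hp
      exact hp
    · rintro ⟨x, hx, rfl⟩
      rw [mem_preimage, hfi]
      exact hx
  · obtain ⟨W₀, hW₀, hiW₀, hW₀W⟩ := mem_nhdsSet_iff_exists.1 hW
    obtain ⟨W₁, hW₁, rfl⟩ := isOpen_induced_iff.1 hW₀
    -- Intersecting with `O` forces the new prisms to lie in `N`.
    obtain ⟨s', ε', hε', hKN', hN'V, -⟩ := exists_ballPrisms_subset hKD hK' (hW₁.inter hO)
      (subset_inter (by
        rintro ⟨_, _⟩ ⟨⟨x, hx, rfl⟩, rfl⟩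
        exact hiW₀ (mem_range_self (⟨x, hx⟩ : K))) hKO)
    have hN'N : ballPrisms D s' ε' ⊆ N := fun p hp => hON ⟨(hN'V hp).2, ballPrisms_subset hp⟩
    have hrange : range (fun y : (Subtype.val ⁻¹' ballPrisms D s' ε' : Set N) =>
        (y : N).val) = ballPrisms D s' ε' := by
      ext p
      constructor
      · rintro ⟨y, rfl⟩
        exact y.2
      · exact fun hp => ⟨⟨⟨p, hN'N hp⟩, hp⟩, rfl⟩
    have hemb : IsEmbedding (fun y : (Subtype.val ⁻¹' ballPrisms D s' ε' : Set N) =>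
        (y : N).val) := IsEmbedding.subtypeVal.comp .subtypeVal
    refine ⟨Subtype.val ⁻¹' ballPrisms D s' ε', ?_, fun p hp => hW₀W (hN'V hp).1,
      ((isCompact_ballPrisms hD s' ε').isClosed.preimage continuous_subtype_val).isCompact,
      IsANESet.isANR hemb (by rw [hrange]; exact isANESet_ballPrisms hD hDc s' ε'),
      isZSet_of_isEmbedding_of_snd_eq_zero hemb hε'
        (by rw [hrange]; exact fun p hp t => mk_max_mem_ballPrisms hε'.le hp t)
        (fun p => (ballPrisms_subset p.2).2) (hiX.preimage continuous_subtype_val)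
        fun y hy => hiX0 _ hy⟩
    rintro _ ⟨x, rfl⟩
    exact hKN' ⟨⟨x, x.2, rfl⟩, rfl⟩
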